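/- Let $n \ge 1$ and let $M$ be a closed (compact, connected, Hausdorff, without boundary) affine $n$-manifold: $M$ carries an atlas of charts $\Phi_\alpha : U_\alpha \to \mathbb{A}^n$ onto open subsets of affine $n$-space such that on each connected component of $U_\alpha \cap U_\beta$ the change of coordinates $\Phi_\beta\circ\Phi_\alpha^{-1}$ is the restriction of an affine automorphism of $\mathbb{A}^n$. Fix $p \in M$ and a chart $\Phi_0$ of the atlas about $p$. For a path $\gamma$ in $M$ starting at $p$, follow $\gamma$ through a finite sequence of charts $\Phi_0,\Phi_1,\dots,\Phi_k$, with change of chart from $\Phi_{i-1}$ to $\Phi_i$ at time $t_i$, and let $g_{i-1,i}$ be the affine automorphism that agrees with $\Phi_{i-1}\circ\Phi_i^{-1}$ on the connected component of $U_{i-1}\cap U_i$ containing $\gamma(t_i)$. The developing map $\mathrm{dev} : \widetilde M \to \mathbb{A}^n$ on the universal cover of $M$ (homotopy classes of paths from $p$) sends $[\gamma]$ to $g_{0,1}\cdots g_{k-1,k}\,\Phi_k(\gamma(1))$, and the affine holonomy $\mathrm{hol} : \pi_1(M,p) \to \mathrm{Aff}(n,\mathbb{R})$ sends the class of a loop $\beta$,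 followed through charts that begin and end with $\Phi_0$, to $g_{0,1}\cdots g_{k-1,k}$. Suppose that $M$ is radiant, i.e. that there is a point $x_0 \in \mathbb{A}^n$ with $\mathrm{hol}[\beta](x_0) = x_0$ for all $[\beta] \in \pi_1(M,p)$. Then, for every such fixed point $x_0$, the developing image does not contain $x_0$: $x_0 \notin \mathrm{dev}(\widetilde M)$. -/

import Mathlib

open scoped unitInterval Topology

noncomputable section

namespace AffineMfd

/-- Affine `n`-space. -/
abbrev ASpace (n : ℕ) : Type := EuclideanSpace ℝ (Fin n)

/-- The group of affine automorphisms of affine `n`-space (multiplication is composition). -/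
abbrev Aff (n : ℕ) : Type := ASpace n ≃ᵃ[ℝ] ASpace n

/-- Coordinate charts: homeomorphisms from open subsets of `M` onto open subsets of affine space. -/
abbrev AChart (n : ℕ) (M : Type*) [TopologicalSpace M] := OpenPartialHomeomorph M (ASpace n)

/-- An affine `n`-manifold: on each connected component `V` of the intersection of the domains of
two charts of the atlas, the change of coordinates is the restriction of an affine automorphism.
(As affine automorphisms are smooth, such an atlas is in particular a smooth atlas, and its charts
are diffeomorphisms for the resulting smooth structure.) -/
class AffineManifold (n : ℕ) (M : Type*) [TopologicalSpace M] [ChartedSpace (ASpace n) M] :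
    Prop where
  exists_transition : ∀ Φ ∈ atlas (ASpace n) M, ∀ Ψ ∈ atlas (ASpace n) M,
    ∀ x ∈ Φ.source ∩ Ψ.source, ∃ A : Aff n,
      ∀ y ∈ connectedComponentIn (Φ.source ∩ Ψ.source) x, Ψ y = A (Φ y)

lemma aff_eq_of_eventuallyEq {n : ℕ} {g k : Aff n} {x : ASpace n} (h : ∀ᶠ y in 𝓝 x, g y = k y) :
    g = k := by
  have hv : ∀ v : ASpace n, g.linear v = k.linear v := by
    intro v
    have hc : Filter.Tendsto (fun t : ℝ => t • v + x) (𝓝[≠] 0) (𝓝 x) := by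
      have : Continuous fun t : ℝ => t • v + x := by fun_prop
      simpa using (this.tendsto 0).mono_left nhdsWithin_le_nhds
    obtain ⟨t, ht, ht0⟩ := ((hc.eventually h).and self_mem_nhdsWithin).exists
    have hx := h.self_of_nhds
    have e1 := g.map_vadd x (t • v)
    have e2 := k.map_vadd x (t • v)
    simp only [vadd_eq_add] at e1 e2
    rw [ht, e2, hx, map_smul, map_smul] at e1
    have := add_right_cancel e1
    exact (smul_right_injective _ ht0 this).symm
  ext1 y
  have hx := h.self_of_nhds
  have e1 := g.map_vadd x (y - x)
  have e2 := k.map_vadd x (y - x)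
  simp only [vadd_eq_add, sub_add_cancel] at e1 e2
  rw [e1, e2, hx, hv]

lemma aff_eq_of_chart {n : ℕ} {M : Type*} [TopologicalSpace M] {Φ : AChart n M} {g k : Aff n}
    {x : M} (hx : x ∈ Φ.source)
    (h : ∀ᶠ y in 𝓝 x, g (Φ y) = k (Φ y)) : g = k := by
  apply aff_eq_of_eventuallyEq (x := Φ x)
  rw [← Φ.map_nhds_eq hx]
  exact h

section

variable {n : ℕ} {M : Type*} [TopologicalSpace M] [ChartedSpace (ASpace n) M]

/-- `Continuation γ Φ₀ t Φ g` says that following the path `γ` on `[0, t]` through a finite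
sequence of charts `Φ₀, Φ₁, …, Φ_k = Φ` of the atlas, at times `0 ≤ t₁ ≤ … ≤ t_k ≤ t` with
`γ [t_i, t_{i+1}]` contained in the domain of `Φ_i`, the accumulated coordinate change is
`g = g₀₁ g₁₂ ⋯ g_{k-1,k}`, where `g_{i-1,i}` is the affine automorphism agreeing with
`Φ_{i-1} ∘ Φ_i⁻¹` on (the image of) the connected component, containing `γ t_i`, of the
intersection of the domains of `Φ_{i-1}` and `Φ_i`. The developed path is then
`g ∘ Φ ∘ γ` near time `t`. -/
inductive Continuation (γ : C(I, M)) (Φ₀ : AChart n M) : I → AChart n M → Aff n → Prop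
  | start (hΦ₀ : Φ₀ ∈ atlas (ASpace n) M) (h : γ 0 ∈ Φ₀.source) : Continuation γ Φ₀ 0 Φ₀ 1
  | move {s t : I} {Φ : AChart n M} {g : Aff n} (hs : Continuation γ Φ₀ s Φ g) (hst : s ≤ t)
      (h : ∀ r ∈ Set.Icc s t, γ r ∈ Φ.source) : Continuation γ Φ₀ t Φ g
  | change {t : I} {Φ Ψ : AChart n M} {g a : Aff n} (ht : Continuation γ Φ₀ t Φ g)
      (hΨ : Ψ ∈ atlas (ASpace n) M) (h : γ t ∈ Ψ.source)
      (ha : ∀ y ∈ connectedComponentIn (Φ.source ∩ Ψ.source) (γ t), Φ y = a (Ψ y)) :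
      Continuation γ Φ₀ t Ψ (g * a)

/-- The universal cover of `M` based at `p`: homotopy classes (rel endpoints) of paths in `M`
starting at `p`, together with their terminal point. (Only its points are needed here.) -/
def UniversalCover (p : M) : Type _ := Σ q : M, Path.Homotopic.Quotient p q

/-- `y` is the terminal point of a developed path in the class `x`, starting from the chart `Φ₀`. -/
def IsDevelopedTo {p : M} (Φ₀ : AChart n M) (x : UniversalCover p) (y : ASpace n) : Prop :=
  ∃ (γ : Path p x.1) (Ψ : AChart n M) (g : Aff n), Path.Homotopic.Quotient.mk γ = x.2 ∧
    Continuation γ.toContinuousMap Φ₀ 1 Ψ g ∧ y = g (Ψ x.1)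

/-- `g` is the total coordinate change along a loop in the class `β`, followed through a sequence
of charts which begins and ends with `Φ₀`. -/
def IsHolonomy {p : M} (Φ₀ : AChart n M) (β : FundamentalGroup M p) (g : Aff n) : Prop :=
  ∃ γ : Path p p, Path.Homotopic.Quotient.mk γ = β.toPath ∧
    Continuation γ.toContinuousMap Φ₀ 1 Φ₀ g

/-! Well-definedness of the developing map and of the holonomy. -/

lemma Continuation.mem {γ : C(I, M)} {Φ₀ Φ : AChart n M} {t : I} {g : Aff n}
    (h : Continuation γ Φ₀ t Φ g) : Φ ∈ atlas (ASpace n) M ∧ γ t ∈ Φ.source := by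
  induction h with
  | start h1 h2 => exact ⟨h1, h2⟩
  | move _ hst h ih => exact ⟨ih.1, h _ ⟨hst, le_rfl⟩⟩
  | change _ hΨ h _ _ => exact ⟨hΨ, h⟩

lemma Continuation.exists_of_le {γ : C(I, M)} {Φ₀ Φ : AChart n M} {t : I} {g : Aff n}
    (h : Continuation γ Φ₀ t Φ g) : ∀ s ≤ t, ∃ Ψ k, Continuation γ Φ₀ s Ψ k := by
  induction h with
  | start h1 h2 =>
    intro s hs
    obtain rfl : s = 0 := le_antisymm hs s.2.1
    exact ⟨_, _, .start h1 h2⟩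
  | @move u t Φ g hu hut h ih =>
    intro s hs
    rcases le_total s u with h1 | h1
    · exact ih s h1
    · exact ⟨_, _, hu.move h1 fun r hr => h r ⟨hr.1, hr.2.trans hs⟩⟩
  | change _ hΨ h _ ih => exact ih

lemma isOpen_component (Φ Ψ : AChart n M) (x : M) :
    IsOpen (connectedComponentIn (Φ.source ∩ Ψ.source) x) := by
  have : LocallyConnectedSpace M := ChartedSpace.locallyConnectedSpace (ASpace n) M
  exact (Φ.open_source.inter Ψ.open_source).connectedComponentIn

/-- The same sequence of charts serves all nearby paths. -/
lemma Continuation.eventually {γ : C(I, M)} {Φ₀ Φ : AChart n M} {t : I} {g : Aff n}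
    (h : Continuation γ Φ₀ t Φ g) : ∀ᶠ γ' : C(I, M) in 𝓝 γ, Continuation γ' Φ₀ t Φ g := by
  have hev : ∀ {t : I} {U : Set M}, IsOpen U → γ t ∈ U → ∀ᶠ γ' : C(I, M) in 𝓝 γ, γ' t ∈ U :=
    fun hU hm => (continuous_eval_const _).continuousAt.preimage_mem_nhds
      (hU.mem_nhds hm)
  induction h with
  | start h1 h2 =>
    filter_upwards [hev Φ₀.open_source h2] with γ' h
    exact .start h1 h
  | @move s t Φ g hs hst hm ih =>
    filter_upwards [ih, ContinuousMap.eventually_mapsTo isCompact_Icc Φ.open_source hm]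
      with γ' h1 h2
    exact h1.move hst h2
  | @change t Φ Ψ g a ht hΨ hm ha ih =>
    filter_upwards [ih, hev (isOpen_component Φ Ψ (γ t))
      (mem_connectedComponentIn ⟨ht.mem.2, hm⟩)] with γ' h1 h2
    refine h1.change hΨ (connectedComponentIn_subset _ _ h2).2 ?_
    rw [← connectedComponentIn_eq h2]
    exact ha

section

variable [AffineManifold n M]

lemma propagate {γ : C(I, M)} {Φ Ψ : AChart n M} (hΦ : Φ ∈ atlas (ASpace n) M)
    (hΨ : Ψ ∈ atlas (ASpace n) M) {g k : Aff n} {s t : I} (hst : s ≤ t)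
    (h : ∀ r ∈ Set.Icc s t, γ r ∈ Φ.source ∩ Ψ.source)
    (hs : ∀ᶠ y in 𝓝 (γ s), g (Φ y) = k (Ψ y)) :
    ∀ᶠ y in 𝓝 (γ t), g (Φ y) = k (Ψ y) := by
  have hs' : s ∈ Set.Icc s t := ⟨le_rfl, hst⟩
  obtain ⟨A, hA⟩ := AffineManifold.exists_transition Φ hΦ Ψ hΨ (γ s) (h s hs')
  have hsub : γ '' Set.Icc s t ⊆ connectedComponentIn (Φ.source ∩ Ψ.source) (γ s) :=
    (isPreconnected_Icc.image γ γ.continuous.continuousOn).subset_connectedComponentIn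
      ⟨s, hs', rfl⟩ (by rintro _ ⟨r, hr, rfl⟩; exact h r hr)
  have hmem : ∀ r ∈ Set.Icc s t,
      ∀ᶠ y in 𝓝 (γ r), y ∈ connectedComponentIn (Φ.source ∩ Ψ.source) (γ s) := fun r hr =>
    (isOpen_component Φ Ψ _).mem_nhds (hsub ⟨r, hr, rfl⟩)
  have hg : g = k * A := by
    apply aff_eq_of_chart (h s hs').1
    filter_upwards [hs, hmem s hs'] with y h1 h2
    rw [h1, hA y h2, AffineEquiv.mul_def]; rfl
  filter_upwards [hmem t ⟨hst, le_rfl⟩] with y h2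
  rw [hA y h2, hg, AffineEquiv.mul_def]; rfl

lemma Continuation.truncate {γ : C(I, M)} {Φ₀ Φ Ψ : AChart n M} {t : I} {k : Aff n}
    (hΦ : Φ ∈ atlas (ASpace n) M) (h : Continuation γ Φ₀ t Ψ k) :
    ∀ (g : Aff n) (s : I), s ≤ t → (∀ r ∈ Set.Icc s t, γ r ∈ Φ.source) →
      ∃ Ψ' k', Continuation γ Φ₀ s Ψ' k' ∧
        ((∀ᶠ y in 𝓝 (γ s), g (Φ y) = k' (Ψ' y)) → ∀ᶠ y in 𝓝 (γ t), g (Φ y) = k (Ψ y)) := by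
  intro g
  induction h with
  | start h1 h2 =>
    intro s hs _
    obtain rfl : s = 0 := le_antisymm hs s.2.1
    exact ⟨_, _, .start h1 h2, id⟩
  | @move u t Ψ k hu hut hm ih =>
    intro s hs h
    rcases le_total s u with h1 | h1
    · obtain ⟨Ψ', k', hc, hi⟩ := ih s h1 fun r hr => h r ⟨hr.1, hr.2.trans hut⟩
      exact ⟨Ψ', k', hc, fun e => propagate hΦ hu.mem.1 hut
        (fun r hr => ⟨h r ⟨h1.trans hr.1, hr.2⟩, hm r hr⟩) (hi e)⟩
    · exact ⟨Ψ, k, hu.move h1 fun r hr => hm r ⟨hr.1, hr.2.trans hs⟩,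
        fun e => propagate hΦ hu.mem.1 hs (fun r hr => ⟨h r hr, hm r ⟨h1.trans hr.1, hr.2⟩⟩) e⟩
  | @change t Φ₁ Ψ k a ht hΨ hm ha ih =>
    intro s hs h
    obtain ⟨Ψ', k', hc, hi⟩ := ih s hs h
    refine ⟨Ψ', k', hc, fun e => ?_⟩
    filter_upwards [hi e, (isOpen_component Φ₁ Ψ (γ t)).mem_nhds
      (mem_connectedComponentIn ⟨ht.mem.2, hm⟩)] with y h1 h2
    rw [h1, ha y h2, AffineEquiv.mul_def]; rfl

/-- Independence of the choice of charts. -/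
lemma Continuation.unique {γ : C(I, M)} {Φ₀ Φ Ψ : AChart n M} {t : I} {g k : Aff n}
    (h : Continuation γ Φ₀ t Φ g) (h' : Continuation γ Φ₀ t Ψ k) :
    ∀ᶠ y in 𝓝 (γ t), g (Φ y) = k (Ψ y) := by
  induction h generalizing Ψ k with
  | start h1 h2 =>
    have key : ∀ t, Continuation γ Φ₀ t Ψ k → t = 0 →
        ∀ᶠ y in 𝓝 (γ 0), (1 : Aff n) (Φ₀ y) = k (Ψ y) := by
      clear h'
      intro t h'
      induction h' with
      | start => exact fun _ => .of_forall fun _ => rfl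
      | move hs hst h ih =>
        intro ht
        exact ih (le_antisymm (ht ▸ hst) unitInterval.nonneg')
      | @change t Φ₁ Ψ k a ht hΨ hm ha ih =>
        rintro rfl
        filter_upwards [ih rfl, (isOpen_component Φ₁ Ψ (γ 0)).mem_nhds
          (mem_connectedComponentIn ⟨ht.mem.2, hm⟩)] with y h1 h2
        rw [h1, ha y h2, AffineEquiv.mul_def]; rfl
    exact key 0 h' rfl
  | @move s t Φ g hs hst hm ih =>
    obtain ⟨Ψ', k', hc, hi⟩ := h'.truncate hs.mem.1 g s hst hm
    exact hi (ih hc)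
  | @change t Φ₁ Φ g a ht hΨ hm ha ih =>
    filter_upwards [ih h', (isOpen_component Φ₁ Φ (γ t)).mem_nhds
      (mem_connectedComponentIn ⟨ht.mem.2, hm⟩)] with y h1 h2
    rw [← h1, ha y h2, AffineEquiv.mul_def]; rfl

lemma Continuation.exists_change {γ : C(I, M)} {Φ₀ Φ Ψ : AChart n M} {t : I} {g : Aff n}
    (h : Continuation γ Φ₀ t Φ g) (hΨ : Ψ ∈ atlas (ASpace n) M) (hm : γ t ∈ Ψ.source) :
    ∃ k, Continuation γ Φ₀ t Ψ k := by
  obtain ⟨A, hA⟩ := AffineManifold.exists_transition Φ h.mem.1 Ψ hΨ (γ t) ⟨h.mem.2, hm⟩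
  exact ⟨_, h.change hΨ hm (a := A⁻¹) fun y hy => by
    rw [hA y hy]; exact (A.symm_apply_apply _).symm⟩

/-- Every path can be developed. -/
lemma exists_continuation {γ : C(I, M)} {Φ₀ : AChart n M} (hΦ₀ : Φ₀ ∈ atlas (ASpace n) M)
    (h0 : γ 0 ∈ Φ₀.source) (t : I) : ∃ Φ g, Continuation γ Φ₀ t Φ g := by
  let P : I → I → Prop := fun s t =>
    (∃ Φ g, Continuation γ Φ₀ s Φ g) → ∃ Φ g, Continuation γ Φ₀ t Φ g
  refine PreconnectedSpace.induction₂' P (fun s => ?_) ⟨fun _ _ _ h1 h2 h => h2 (h1 h)⟩ 0 t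
    ⟨_, _, .start hΦ₀ h0⟩
  let Ψ : AChart n M := chartAt (ASpace n) (γ s)
  have hΨ : Ψ ∈ atlas (ASpace n) M := chart_mem_atlas _ _
  have hN : γ ⁻¹' Ψ.source ∈ 𝓝 s :=
    γ.continuous.continuousAt.preimage_mem_nhds (Ψ.open_source.mem_nhds (mem_chart_source _ _))
  obtain ⟨b, c, hs, hbc, hN1⟩ := exists_Icc_mem_subset_of_mem_nhds hN
  have key : ∀ x ∈ Set.Icc b c, ∀ y ∈ Set.Icc b c, P x y := by
    rintro x hx y hy ⟨Φ, g, hc⟩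
    rcases le_total y x with h | h
    · exact hc.exists_of_le y h
    · obtain ⟨k, hk⟩ := hc.exists_change hΨ (hN1 hx)
      exact ⟨_, _, hk.move h fun r hr => hN1 ⟨hx.1.trans hr.1, hr.2.trans hy.2⟩⟩
  filter_upwards [hbc] with r hr
  exact ⟨key _ hs _ hr, key _ hr _ hs⟩

/-- Invariance under homotopies relative to the endpoints. -/
lemma Continuation.homotopic {p q : M} {γ γ' : Path p q} (H : γ.Homotopic γ')
    {Φ₀ Φ Ψ : AChart n M} {g k : Aff n} (h : Continuation γ.toContinuousMap Φ₀ 1 Φ g)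
    (h' : Continuation γ'.toContinuousMap Φ₀ 1 Ψ k) : ∀ᶠ y in 𝓝 q, g (Φ y) = k (Ψ y) := by
  obtain ⟨F⟩ := H
  let c : C(I, C(I, M)) := F.toHomotopy.curry
  have hc0 : ∀ s, c s 0 = p := fun s => (F.eval s).source
  have hc1 : ∀ s, c s 1 = q := fun s => (F.eval s).target
  have h0 : γ.toContinuousMap 0 ∈ Φ₀.source ∧ Φ₀ ∈ atlas (ASpace n) M := by
    have key : ∀ {t Φ g}, Continuation γ.toContinuousMap Φ₀ t Φ g →
        γ.toContinuousMap 0 ∈ Φ₀.source ∧ Φ₀ ∈ atlas (ASpace n) M := by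
      intro t Φ g h
      induction h with
      | start h1 h2 => exact ⟨h2, h1⟩
      | move _ _ _ ih => exact ih
      | change _ _ _ _ ih => exact ih
    exact key h
  have hp : p ∈ Φ₀.source := by simpa using h0.1
  let P : I → I → Prop := fun s t => ∀ Φ Ψ g k, Continuation (c s) Φ₀ 1 Φ g →
    Continuation (c t) Φ₀ 1 Ψ k → ∀ᶠ y in 𝓝 q, g (Φ y) = k (Ψ y)
  have hP : P 0 1 := by
    refine PreconnectedSpace.induction₂' P (fun s => ?_) ⟨fun s t u h1 h2 Φ Ψ g k hs hu => ?_⟩ 0 1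
    · obtain ⟨Φ, g, hs⟩ := exists_continuation (γ := c s) h0.2 (by rw [hc0]; exact hp) 1
      filter_upwards [c.continuous.continuousAt.eventually hs.eventually] with t ht
      constructor
      · intro Φ' Ψ' g' k' h1 h2
        have e1 := h1.unique hs
        have e2 := ht.unique h2
        rw [hc1] at e1 e2
        filter_upwards [e1, e2] with y a b using a.trans b
      · intro Φ' Ψ' g' k' h1 h2
        have e1 := h1.unique ht
        have e2 := hs.unique h2
        rw [hc1] at e1 e2
        filter_upwards [e1, e2] with y a b using a.trans b
    · obtain ⟨Φ', g', ht⟩ := exists_continuation (γ := c t) h0.2 (by rw [hc0]; exact hp) 1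
      filter_upwards [h1 _ _ _ _ hs ht, h2 _ _ _ _ ht hu] with y a b using a.trans b
  have e0 : c 0 = γ.toContinuousMap := F.toHomotopy.curry_zero
  have e1 : c 1 = γ'.toContinuousMap := F.toHomotopy.curry_one
  exact hP Φ Ψ g k (e0 ▸ h) (e1 ▸ h')

theorem existsUnique_isDevelopedTo {p : M} {Φ₀ : AChart n M} (hΦ₀ : Φ₀ ∈ atlas (ASpace n) M)
    (hp : p ∈ Φ₀.source) (x : UniversalCover p) : ∃! y, IsDevelopedTo Φ₀ x y := by
  obtain ⟨q, c⟩ := x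
  induction c using Path.Homotopic.Quotient.ind with
  | mk γ =>
    obtain ⟨Ψ, g, h⟩ := exists_continuation (γ := γ.toContinuousMap) hΦ₀ (by simpa using hp) 1
    refine ⟨_, ⟨γ, Ψ, g, rfl, h, rfl⟩, ?_⟩
    rintro y ⟨γ', Ψ', g', e, h', rfl⟩
    exact (h'.homotopic (Path.Homotopic.Quotient.exact e) h).self_of_nhds

theorem existsUnique_isHolonomy {p : M} {Φ₀ : AChart n M} (hΦ₀ : Φ₀ ∈ atlas (ASpace n) M)
    (hp : p ∈ Φ₀.source) (β : FundamentalGroup M p) : ∃! g, IsHolonomy Φ₀ β g := by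
  obtain ⟨γ, hγ⟩ := Path.Homotopic.Quotient.mk_surjective β.toPath
  obtain ⟨Ψ, g, h⟩ := exists_continuation (γ := γ.toContinuousMap) hΦ₀ (by simpa using hp) 1
  obtain ⟨k, hk⟩ := h.exists_change hΦ₀ (by simpa using hp)
  refine ⟨k, ⟨γ, hγ, hk⟩, ?_⟩
  rintro g' ⟨γ', e, h'⟩
  exact aff_eq_of_chart hp (h'.homotopic (Path.Homotopic.Quotient.exact (e.trans hγ.symm)) hk)

/-- The developing map determined by the chart `Φ₀` about `p`: a homotopy class of paths is sent
to the terminal point of the developed path. -/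
def dev {p : M} {Φ₀ : AChart n M} (hΦ₀ : Φ₀ ∈ atlas (ASpace n) M) (hp : p ∈ Φ₀.source)
    (x : UniversalCover p) : ASpace n :=
  (existsUnique_isDevelopedTo hΦ₀ hp x).choose

/-- The affine holonomy determined by the chart `Φ₀` about `p`. -/
def hol {p : M} {Φ₀ : AChart n M} (hΦ₀ : Φ₀ ∈ atlas (ASpace n) M) (hp : p ∈ Φ₀.source)
    (β : FundamentalGroup M p) : Aff n :=
  (existsUnique_isHolonomy hΦ₀ hp β).choose

end

end

end AffineMfd

end

noncomputable section

namespace AffineMfd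

open Set Filter

/-! Suppose `x₀` is developed from a point over `q`. With `x₀` moved to the origin the holonomy is
linear, so the continuations of `Φ₀` form an atlas with locally linear transitions
(`isRadiantAtlas_continuedCharts`), and one of its charts `f` vanishes at `q`. Linear maps commute
with scalings, so the radial flow is well defined on `M` (`IsRadialShift.unique`), and compactness
provides a single `c > 1` and a map `h : M → M` that is scaling by `c` in charts.

A zero of the radial field is a source of this flow, and its unstable manifold is a copy of the
whole model space: `F v = h^k (f⁻¹ (c⁻ᵏ v))`, for `k` large, extends `f⁻¹` from a ball to all of
`E`. It is injective because `h` is, and open because it is locally linear (`IsLinearAt.nhds_le`).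
Its range is closed, since a locally linear map reaching a chart ball covers that ball
(`isClosed_range_of_isLinearAt`). Thus the noncompact `E` would embed as a closed subset of the
compact `M`. -/

/-- Two continuous maps on a preconnected set which agree near every point where they agree
coincide as soon as they agree at one point. -/
lemma eqOn_of_eventuallyEq {X Y : Type*} [TopologicalSpace X] [TopologicalSpace Y] [T2Space Y]
    {s : Set X} (hs : IsPreconnected s) {c c' : X → Y} (hc : ContinuousOn c s)
    (hc' : ContinuousOn c' s) (hloc : ∀ t ∈ s, c t = c' t → ∀ᶠ u in 𝓝 t, c u = c' u)
    {a : X} (ha : a ∈ s) (hac : c a = c' a) : EqOn c c' s := by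
  have := isPreconnected_iff_preconnectedSpace.mp hs
  have hcl : IsClopen {t : s | c t = c' t} := by
    refine ⟨isClosed_eq (continuousOn_iff_continuous_domRestrict.1 hc)
      (continuousOn_iff_continuous_domRestrict.1 hc'), ?_⟩
    rw [isOpen_iff_eventually]
    intro t ht
    exact continuous_subtype_val.continuousAt.eventually (hloc t t.2 ht)
  have h := hcl.eq_univ ⟨⟨a, ha⟩, hac⟩
  intro t ht
  have : (⟨t, ht⟩ : s) ∈ {t : s | c t = c' t} := h ▸ mem_univ _
  exact this

/-! ### Radiant atlases and their radial flow -/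

section

variable {M E : Type*} [TopologicalSpace M] [NormedAddCommGroup E] [NormedSpace ℝ E]

/-- An atlas all of whose changes of coordinates are locally linear. -/
structure IsRadiantAtlas (R : Set (OpenPartialHomeomorph M E)) : Prop where
  exists_mem : ∀ x, ∃ f ∈ R, x ∈ f.source
  exists_linear : ∀ f ∈ R, ∀ f' ∈ R, ∀ x ∈ f.source, x ∈ f'.source →
    ∃ A : E ≃L[ℝ] E, ∀ᶠ y in 𝓝 x, f' y = A (f y)

/-- The radiant flow moves `x` to `y`, inside a single chart, in time `log c`. -/
def IsRadialShift (R : Set (OpenPartialHomeomorph M E)) (c : ℝ) (x y : M) : Prop :=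
  ∃ f ∈ R, ∃ C : Set E, Convex ℝ C ∧ IsOpen C ∧ C ⊆ f.target ∧ x ∈ f.source ∧ y ∈ f.source ∧
    f x ∈ C ∧ f y = c • f x ∧ c • f x ∈ C

lemma IsRadialShift.symm {R : Set (OpenPartialHomeomorph M E)} {c : ℝ} (hc : 0 < c) {x y : M}
    (h : IsRadialShift R c x y) : IsRadialShift R c⁻¹ y x := by
  obtain ⟨f, hf, C, h1, h2, h3, h4, h5, h6, h7, h8⟩ := h
  have : f x = c⁻¹ • f y := by rw [h7, inv_smul_smul₀ hc.ne']
  exact ⟨f, hf, C, h1, h2, h3, h5, h4, h7 ▸ h8, this, this ▸ h6⟩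

lemma continuousOn_radial {f : OpenPartialHomeomorph M E} {s : Set ℝ} {v : E}
    (h : ∀ t ∈ s, t • v ∈ f.target) : ContinuousOn (fun t : ℝ => f.symm (t • v)) s :=
  f.continuousOn_symm.comp (by fun_prop) h

/-- Both charts give an orbit `t ↦ t • v` starting at `x`. Where the orbits meet, linearity of the
transition lets the factor `t` be cancelled, so the transition carries `f x` to `f' x` and the
orbits agree nearby; connectedness of the time interval does the rest. -/
lemma IsRadialShift.unique [T2Space M] {R : Set (OpenPartialHomeomorph M E)}
    (hR : IsRadiantAtlas R) {c : ℝ} (hc : 0 < c) {x y y' : M} (h : IsRadialShift R c x y)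
    (h' : IsRadialShift R c x y') : y = y' := by
  obtain ⟨f, hf, C, h1, h2, h3, h4, h5, h6, h7, h8⟩ := h
  obtain ⟨f', hf', C', h1', h2', h3', h4', h5', h6', h7', h8'⟩ := h'
  -- Convexity keeps the whole orbit in the chart. The interval is unordered because the lemma is
  -- also applied to `c⁻¹ < 1`.
  have key : ∀ (g : OpenPartialHomeomorph M E) (D : Set E), Convex ℝ D → D ⊆ g.target →
      g x ∈ D → c • g x ∈ D → ∀ t ∈ uIcc 1 c, t • g x ∈ g.target := by
    intro g D hD hDg hx hcx t ht
    have ho : Convex ℝ ((fun t : ℝ => t • g x) ⁻¹' D) :=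
      hD.is_linear_preimage (IsLinearMap.mk (fun a b => add_smul a b _) fun a b => by
        simp [mul_smul])
    exact hDg (ho.ordConnected.uIcc_subset (by simpa using hx) hcx ht)
  have k := key f C h1 h3 h6 h8
  have k' := key f' C' h1' h3' h6' h8'
  have := eqOn_of_eventuallyEq (isPreconnected_uIcc (a := (1 : ℝ)) (b := c))
    (continuousOn_radial k) (continuousOn_radial k') ?_ left_mem_uIcc
    (by simp only [one_smul]; rw [f.left_inv h4, f'.left_inv h4'])
  · have e := this right_mem_uIcc
    simp only at e
    rwa [← h7, ← h7', f.left_inv h5, f'.left_inv h5'] at e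
  · intro t ht e
    have hpos : 0 < t := lt_of_lt_of_le (lt_min one_pos hc) ht.1
    have hz := f.map_target (k t ht)
    have hz' : f.symm (t • f x) ∈ f'.source := e ▸ f'.map_target (k' t ht)
    obtain ⟨A, hA⟩ := hR.exists_linear f hf f' hf' _ hz hz'
    have hAx : A (f x) = f' x := by
      have := hA.self_of_nhds
      rw [e, f'.right_inv (k' t ht), ← e, f.right_inv (k t ht), map_smul] at this
      exact (smul_right_injective _ hpos.ne' this).symm
    have hcont : ContinuousAt (fun u : ℝ => f.symm (u • f x)) t :=
      ContinuousAt.comp (f.continuousAt_symm (k t ht)) (by fun_prop)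
    have ht1 : ∀ᶠ u : ℝ in 𝓝 t, u • f x ∈ f.target :=
      (by fun_prop : ContinuousAt (fun u : ℝ => u • f x) t).eventually
        (f.open_target.mem_nhds (k t ht))
    filter_upwards [hcont.eventually hA, ht1, hcont.eventually (f'.open_source.mem_nhds hz')]
      with u hu1 hu2 hu3
    have hu3' : f.symm (u • f x) ∈ f'.source := hu3
    rw [f.right_inv hu2, map_smul, hAx] at hu1
    rw [← hu1, f'.left_inv hu3']

/-- Uniqueness for the reversed flow; it makes the time-`log c` map injective. -/
lemma IsRadialShift.unique_left [T2Space M] {R : Set (OpenPartialHomeomorph M E)}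
    (hR : IsRadiantAtlas R) {c : ℝ} (hc : 0 < c) {x x' y : M} (h : IsRadialShift R c x y)
    (h' : IsRadialShift R c x' y) : x = x' :=
  (h.symm hc).unique hR (inv_pos.2 hc) (h'.symm hc)

lemma isRadialShift_of_mem {R : Set (OpenPartialHomeomorph M E)} {f : OpenPartialHomeomorph M E}
    (hf : f ∈ R) {C : Set E} (hC : Convex ℝ C) (hCo : IsOpen C) (hCt : C ⊆ f.target) {c : ℝ}
    {x : M} (hx : x ∈ f.source) (h : f x ∈ C) (hc : c • f x ∈ C) :
    IsRadialShift R c x (f.symm (c • f x)) :=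
  ⟨f, hf, C, hC, hCo, hCt, hx, f.map_target (hCt hc), h, f.right_inv (hCt hc), hc⟩

/-- By compactness, the radiant flow exists everywhere for a uniform positive time. -/
lemma IsRadiantAtlas.exists_isRadialShift [CompactSpace M] {R : Set (OpenPartialHomeomorph M E)}
    (hR : IsRadiantAtlas R) : ∃ c : ℝ, 1 < c ∧ ∀ x, ∃ y, IsRadialShift R c x y := by
  -- At `c = 1` the flow is stationary, so for `(c, z)` near `(1, x)` both `f z` and `c • f z` stay
  -- in one ball of the chart.
  have h : ∀ᶠ c : ℝ in 𝓝 1, ∀ x ∈ (univ : Set M), ∃ y, IsRadialShift R c x y := by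
    refine isCompact_univ.eventually_forall_of_forall_eventually fun x _ => ?_
    obtain ⟨f, hf, hx⟩ := hR.exists_mem x
    obtain ⟨r, hr, hrt⟩ := Metric.isOpen_iff.1 f.open_target (f x) (f.map_source hx)
    have hfx : Tendsto (fun z : ℝ × M => f z.2) (𝓝 (1, x)) (𝓝 (f x)) :=
      (f.continuousAt hx).tendsto.comp continuousAt_snd
    have h2 : Tendsto (fun z : ℝ × M => z.1 • f z.2) (𝓝 (1, x)) (𝓝 (f x)) := by
      have h1 : Tendsto (fun z : ℝ × M => z.1) (𝓝 (1, x)) (𝓝 1) := continuousAt_fst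
      simpa using h1.smul hfx
    have h3 : ∀ᶠ z : ℝ × M in 𝓝 (1, x), z.2 ∈ f.source :=
      continuousAt_snd.eventually (f.open_source.mem_nhds hx)
    filter_upwards [hfx (Metric.ball_mem_nhds _ hr), h2 (Metric.ball_mem_nhds _ hr), h3]
      with z z1 z2 z3
    exact ⟨_, isRadialShift_of_mem hf (convex_ball _ _) Metric.isOpen_ball hrt z3 z1 z2⟩
  obtain ⟨c, hc, hc1⟩ := ((h.filter_mono nhdsWithin_le_nhds).and
    (self_mem_nhdsWithin : Ioi (1 : ℝ) ∈ 𝓝[>] 1)).exists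
  exact ⟨c, hc1, fun x => hc x (mem_univ x)⟩

/-! ### Locally linear maps from the model space -/

/-- The map `e` is a linear isomorphism near `v` when read in a chart of `R`. -/
def IsLinearAt (R : Set (OpenPartialHomeomorph M E)) (e : E → M) (v : E) : Prop :=
  ContinuousAt e v ∧ ∃ g ∈ R, e v ∈ g.source ∧ ∃ A : E ≃L[ℝ] E, ∀ᶠ w in 𝓝 v, g (e w) = A w

section

variable {R : Set (OpenPartialHomeomorph M E)} {e : E → M} {v : E}

lemma IsLinearAt.exists_linear (hR : IsRadiantAtlas R) (h : IsLinearAt R e v)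
    {g : OpenPartialHomeomorph M E} (hg : g ∈ R) (hv : e v ∈ g.source) :
    ∃ A : E ≃L[ℝ] E, ∀ᶠ w in 𝓝 v, g (e w) = A w := by
  obtain ⟨hc, f, hf, hvf, A, hA⟩ := h
  obtain ⟨B, hB⟩ := hR.exists_linear f hf g hg _ hvf hv
  refine ⟨A.trans B, ?_⟩
  filter_upwards [hA, hc.eventually hB] with w h1 h2
  simp [h2, h1]

lemma IsLinearAt.congr (h : IsLinearAt R e v) {e' : E → M} (he : e =ᶠ[𝓝 v] e') :
    IsLinearAt R e' v := by
  obtain ⟨hc, f, hf, hvf, A, hA⟩ := h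
  refine ⟨hc.congr he, f, hf, he.self_of_nhds ▸ hvf, A, ?_⟩
  filter_upwards [hA, he] with w h1 h2
  rw [← h2, h1]

lemma isLinearAt_symm_smul {f : OpenPartialHomeomorph M E} (hf : f ∈ R) {c : ℝ} (hc : c ≠ 0)
    (hv : c • v ∈ f.target) : IsLinearAt R (fun w => f.symm (c • w)) v := by
  have hs : ContinuousAt (fun w : E => c • w) v := by fun_prop
  refine ⟨ContinuousAt.comp (f.continuousAt_symm hv) hs, f, hf,
    f.map_target hv, ContinuousLinearEquiv.smulLeft (Units.mk0 c hc), ?_⟩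
  filter_upwards [hs.eventually (f.open_target.mem_nhds hv)] with w hw
  rw [f.right_inv hw]; rfl

/-- Uniqueness of shifts identifies `h` with scaling by `c` in one fixed chart near `e v`; no
continuity of `h` is assumed. -/
lemma IsLinearAt.comp_shift [T2Space M] (hR : IsRadiantAtlas R) {c : ℝ} (hc : 0 < c) {h : M → M}
    (hh : ∀ x, IsRadialShift R c x (h x)) (he : IsLinearAt R e v) :
    IsLinearAt R (fun w => h (e w)) v := by
  obtain ⟨f, hf, C, h1, h2, h3, h4, h5, h6, h7, h8⟩ := hh (e v)
  obtain ⟨A, hA⟩ := he.exists_linear hR hf h4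
  have hfv : A v = f (e v) := hA.self_of_nhds.symm
  have hAc : ContinuousAt (fun w => A w) v := A.continuous.continuousAt
  have hAc' : ContinuousAt (fun w => c • A w) v := hAc.const_smul c
  have heq : (fun w => f.symm (c • A w)) =ᶠ[𝓝 v] fun w => h (e w) := by
    filter_upwards [hA, he.1.eventually (f.open_source.mem_nhds h4),
      hAc.eventually (h2.mem_nhds (hfv.symm ▸ h6 : A v ∈ C)),
      hAc'.eventually (h2.mem_nhds (hfv.symm ▸ h8 : c • A v ∈ C))] with w w1 w2 w3 w4
    rw [← w1] at w3 w4 ⊢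
    exact (isRadialShift_of_mem hf h1 h2 h3 w2 w3 w4).unique hR hc (hh _)
  refine IsLinearAt.congr ?_ heq
  have ht : c • A v ∈ f.target := by rw [hfv]; exact h3 h8
  refine ⟨ContinuousAt.comp (f.continuousAt_symm ht) hAc', f, hf, f.map_target ht,
    A.trans (ContinuousLinearEquiv.smulLeft (Units.mk0 c hc.ne')), ?_⟩
  filter_upwards [hAc'.eventually (f.open_target.mem_nhds ht)] with w hw
  rw [f.right_inv hw]; rfl

lemma IsLinearAt.nhds_le (h : IsLinearAt R e v) : 𝓝 (e v) ≤ map e (𝓝 v) := by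
  obtain ⟨hc, f, hf, hvf, A, hA⟩ := h
  have heq : (fun w => f.symm (A w)) =ᶠ[𝓝 v] e := by
    filter_upwards [hA, hc.eventually (f.open_source.mem_nhds hvf)] with w h1 h2
    rw [← h1, f.left_inv h2]
  have h1 : map A (𝓝 v) = 𝓝 (A v) := A.toHomeomorph.map_nhds_eq v
  have h2 : map (fun w => f.symm (A w)) (𝓝 v) = map f.symm (map A (𝓝 v)) := map_map.symm
  rw [← map_congr heq, h2, h1, ← hA.self_of_nhds, f.symm_map_nhds_eq hvf]

/-- A map which is everywhere locally linear has closed range. -/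
lemma isClosed_range_of_isLinearAt [T2Space M] (hR : IsRadiantAtlas R)
    (he : ∀ v, IsLinearAt R e v) : IsClosed (range e) := by
  have hec : Continuous e := continuous_iff_continuousAt.2 fun v => (he v).1
  refine isClosed_of_closure_subset fun y hy => ?_
  obtain ⟨g, hg, hyg⟩ := hR.exists_mem y
  obtain ⟨r, hr, hrt⟩ := Metric.isOpen_iff.1 g.open_target (g y) (g.map_source hyg)
  set C := Metric.ball (g y) r
  have hN : g.source ∩ g ⁻¹' C ∈ 𝓝 y :=
    inter_mem (g.open_source.mem_nhds hyg) (g.continuousAt hyg (Metric.ball_mem_nhds _ hr))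
  obtain ⟨_, ⟨hvs, hvC⟩, v, rfl⟩ := mem_closure_iff_nhds.1 hy _ hN
  obtain ⟨A, hA⟩ := (he v).exists_linear hR hg hvs
  -- Equality of germs makes `U` open by construction; what remains is that it is closed relative to
  -- the ball `C`.
  let U : Set E := {t | ∀ᶠ u in 𝓝 t, e (A.symm u) = g.symm u}
  have hU : IsOpen U := isOpen_setOfPred_eventually_nhds
  have hsub : C ⊆ U := by
    refine (convex_ball (g y) r).isPreconnected.subset_of_closure_inter_subset hU ?_ ?_
    · refine ⟨g (e v), hvC, ?_⟩
      have hAv : A.symm (g (e v)) = v := by rw [hA.self_of_nhds, A.symm_apply_apply]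
      have hc : Tendsto A.symm (𝓝 (g (e v))) (𝓝 v) := by
        simpa only [hAv] using A.symm.continuous.tendsto (g (e v))
      filter_upwards [hc.eventually hA, (hec.continuousAt.tendsto.comp hc).eventually
        (g.open_source.mem_nhds hvs)] with u h1 h2
      rw [A.apply_symm_apply] at h1
      exact (g.left_inv h2).symm.trans (congrArg g.symm h1)
    · rintro t ⟨htc, htC⟩
      have htT := hrt htC
      have hgs := g.continuousAt_symm htT
      have hes : ContinuousAt (fun u => e (A.symm u)) t :=
        (hec.comp A.symm.continuous).continuousAt
      have heq : e (A.symm t) = g.symm t := by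
        have : (𝓝[U] t).NeBot := mem_closure_iff_nhdsWithin_neBot.1 htc
        refine tendsto_nhds_unique_of_eventuallyEq (hes.mono_left nhdsWithin_le_nhds)
          (hgs.mono_left (nhdsWithin_le_nhds (s := U))) ?_
        filter_upwards [self_mem_nhdsWithin] with u hu using hu.self_of_nhds
      have hts : e (A.symm t) ∈ g.source := heq ▸ g.map_target htT
      obtain ⟨B, hB⟩ := (he _).exists_linear hR hg hts
      have hc := A.symm.continuous.tendsto t
      have hloc : ∀ᶠ u in 𝓝 t, g (e (A.symm u)) = B (A.symm u) ∧ u ∈ g.target ∧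
          e (A.symm u) ∈ g.source := by
        filter_upwards [hc.eventually hB, g.open_target.mem_nhds htT,
          hes.eventually (g.open_source.mem_nhds hts)] with u h1 h2 h3 using ⟨h1, h2, h3⟩
      -- `B ∘ A⁻¹` is the identity near a point `u₀` of `U` close to `t`, and a linear map is
      -- determined by its values on an open set.
      have hBA : ∀ u, B (A.symm u) = u := by
        obtain ⟨V, hV, hVo, htV⟩ := eventually_nhds_iff.1 hloc
        obtain ⟨u₀, hu₀V, hu₀⟩ := mem_closure_iff.1 htc V hVo htV
        have hev : ∀ᶠ u in 𝓝 u₀, B (A.symm u) = u := by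
          filter_upwards [hu₀, hVo.mem_nhds hu₀V] with u h1 h2
          rw [← (hV u h2).1, h1, g.right_inv (hV u h2).2.1]
        intro w
        have hline : Tendsto (fun s : ℝ => u₀ + s • w) (𝓝[≠] 0) (𝓝 u₀) := by
          have : Continuous fun s : ℝ => u₀ + s • w := by fun_prop
          simpa using (this.tendsto 0).mono_left nhdsWithin_le_nhds
        obtain ⟨s, hs, hs0⟩ := ((hline.eventually hev).and self_mem_nhdsWithin).exists
        have h0 := hev.self_of_nhds
        simp only [map_add, map_smul, h0] at hs
        exact smul_right_injective _ hs0 (add_left_cancel hs)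
      filter_upwards [hloc] with u ⟨h1, h2, h3⟩
      rw [hBA] at h1
      exact (g.left_inv h3).symm.trans (congrArg g.symm h1)
  have := (hsub (Metric.mem_ball_self hr : g y ∈ C)).self_of_nhds
  rw [g.left_inv hyg] at this
  exact ⟨_, this⟩

end

/-! ### The radial field has no zeros -/

/-- On a compact Hausdorff space with a radiant atlas modelled on a nontrivial vector space, the
radiant vector field has no zeros. -/
theorem IsRadiantAtlas.apply_ne_zero [T2Space M] [CompactSpace M] [Nontrivial E]
    {R : Set (OpenPartialHomeomorph M E)} (hR : IsRadiantAtlas R) {f : OpenPartialHomeomorph M E}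
    (hf : f ∈ R) {q : M} (hq : q ∈ f.source) : f q ≠ 0 := by
  intro h0
  obtain ⟨c, hc1, hc⟩ := hR.exists_isRadialShift
  choose h hh using hc
  have hc0 : 0 < c := one_pos.trans hc1
  have hinj : Function.Injective h := fun x x' e =>
    (hh x).unique_left hR hc0 (e ▸ hh x')
  obtain ⟨r, hr, hrt⟩ := Metric.isOpen_iff.1 f.open_target 0 (h0 ▸ f.map_source hq)
  have hstep : ∀ w : E, ‖c • w‖ < r → h (f.symm w) = f.symm (c • w) := by
    intro w hw
    have hw' : ‖w‖ < r := by
      refine lt_of_le_of_lt ?_ hw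
      rw [norm_smul, Real.norm_of_nonneg hc0.le]
      exact le_mul_of_one_le_left (norm_nonneg _) hc1.le
    have m : ∀ {u : E}, ‖u‖ < r → u ∈ Metric.ball (0 : E) r := fun h => by simpa using h
    have hs := f.right_inv (hrt (m hw'))
    have := isRadialShift_of_mem (c := c) hf (convex_ball 0 r) Metric.isOpen_ball hrt
      (f.map_target (hrt (m hw'))) (by rw [hs]; exact m hw') (by rw [hs]; exact m hw)
    rw [hs] at this
    exact (hh _).unique hR hc0 this
  -- Contract `v` into the ball of radius `r`, then flow back out `k` times.
  let e : ℕ → E → M := fun k v => h^[k] (f.symm ((c⁻¹ ^ k) • v))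
  have hci : ∀ k, c⁻¹ ^ k ≠ 0 := fun k => pow_ne_zero _ (inv_ne_zero hc0.ne')
  have hmono : ∀ {k l : ℕ} {v : E}, k ≤ l → ‖(c⁻¹ ^ k) • v‖ < r → ‖(c⁻¹ ^ l) • v‖ < r := by
    intro k l v hkl hk
    refine lt_of_le_of_lt ?_ hk
    simp only [norm_smul, norm_pow, norm_inv, Real.norm_of_nonneg hc0.le]
    exact mul_le_mul_of_nonneg_right (pow_le_pow_of_le_one (inv_nonneg.2 hc0.le)
      (inv_le_one_of_one_le₀ hc1.le) hkl) (norm_nonneg _)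
  -- Inside the ball, one application of `h` undoes one extra contraction, so the value does not
  -- depend on a sufficiently large exponent.
  have hestab : ∀ {k l : ℕ} {v : E}, k ≤ l → ‖(c⁻¹ ^ k) • v‖ < r → e l v = e k v := by
    intro k l v hkl hk
    induction l, hkl using Nat.le_induction with
    | base => rfl
    | succ l hl ih =>
      have hcc : c • c⁻¹ ^ (l + 1) • v = c⁻¹ ^ l • v := by
        rw [smul_smul, pow_succ', mul_inv_cancel_left₀ hc0.ne']
      rw [← ih]
      change h^[l + 1] _ = h^[l] _
      rw [Function.iterate_succ_apply, hstep _ (by rw [hcc]; exact hmono hl hk), hcc]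
  have hex : ∀ v : E, ∃ k : ℕ, ‖(c⁻¹ ^ k) • v‖ < r := by
    intro v
    have ht : Tendsto (fun k : ℕ => ‖(c⁻¹ ^ k) • v‖) atTop (𝓝 0) := by
      have := (tendsto_pow_atTop_nhds_zero_of_lt_one (inv_nonneg.2 hc0.le)
        (inv_lt_one_of_one_lt₀ hc1)).smul_const v
      simpa using this.norm
    exact (ht.eventually (gt_mem_nhds hr)).exists
  choose K hK using hex
  let F : E → M := fun v => e (K v) v
  have hF : ∀ {k : ℕ} {v : E}, ‖(c⁻¹ ^ k) • v‖ < r → F v = e k v := by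
    intro k v hk
    rcases le_total k (K v) with hl | hl
    · exact hestab hl hk
    · exact (hestab hl (hK v)).symm
  have hiter : ∀ (m k : ℕ) (v : E), ‖(c⁻¹ ^ k) • v‖ < r →
      IsLinearAt R (fun w => h^[m] (f.symm ((c⁻¹ ^ k) • w))) v := by
    intro m k v hk
    induction m with
    | zero => exact isLinearAt_symm_smul hf (hci k) (hrt (by simpa using hk))
    | succ m ih =>
      simp only [Function.iterate_succ_apply']
      exact ih.comp_shift hR hc0 hh
  have hlin : ∀ v, IsLinearAt R F v := by
    intro v
    -- `K` is an arbitrary choice and need not be locally constant; the exponent `K v` still works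
    -- for all `w` near `v`.
    refine (hiter (K v) (K v) v (hK v)).congr ?_
    have : ContinuousAt (fun w : E => ‖(c⁻¹ ^ K v) • w‖) v := by fun_prop
    filter_upwards [this.eventually (gt_mem_nhds (hK v))] with w hw using (hF hw).symm
  have hFinj : Function.Injective F := by
    intro v w hvw
    have hv := hmono (le_max_left (K v) (K w)) (hK v)
    have hw := hmono (le_max_right (K v) (K w)) (hK w)
    rw [hF hv, hF hw] at hvw
    have := f.symm.injOn (hrt (by simpa using hv)) (hrt (by simpa using hw))
      (hinj.iterate _ hvw)
    exact smul_right_injective _ (hci _) this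
  have hemb : Topology.IsClosedEmbedding F :=
    ⟨(Topology.IsOpenEmbedding.of_continuous_injective_isOpenMap
      (continuous_iff_continuousAt.2 fun v => (hlin v).1) hFinj
      (IsOpenMap.of_nhds_le fun v => (hlin v).nhds_le)).isEmbedding,
      isClosed_range_of_isLinearAt hR hlin⟩
  have := hemb.compactSpace
  have := NormedSpace.noncompactSpace ℝ E
  exact not_compactSpace_iff.2 this ‹_›

end

/-! ### Continued charts form a radiant atlas -/

section

variable {n : ℕ} {M : Type*} [TopologicalSpace M] [ChartedSpace (ASpace n) M]

lemma Continuation.mem_start {γ : C(I, M)} {Φ₀ Φ : AChart n M} {t : I} {g : Aff n}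
    (h : Continuation γ Φ₀ t Φ g) : Φ₀ ∈ atlas (ASpace n) M ∧ γ 0 ∈ Φ₀.source := by
  induction h with
  | start h1 h2 => exact ⟨h1, h2⟩
  | move _ _ _ ih => exact ih
  | change _ _ _ _ ih => exact ih

/-- A continuation along `γ` can be transported to a path which traverses `γ` on a subinterval. -/
lemma Continuation.reparam {γ δ : C(I, M)} {Φ₀ Φ Ψ : AChart n M} {g k : Aff n} {t : I}
    {φ : I → I} (hφ : Continuous φ) (hm : Monotone φ) (hγ : ∀ r, δ (φ r) = γ r)
    (h0 : Continuation δ Φ₀ (φ 0) Φ g) (h : Continuation γ Φ t Ψ k) :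
    Continuation δ Φ₀ (φ t) Ψ (g * k) := by
  induction h with
  | start _ _ => rwa [mul_one]
  | @move s t Ψ k hs hst hr ih =>
    refine ih.move (hm hst) fun r hr' => ?_
    obtain ⟨r', hr1, rfl⟩ := intermediate_value_Icc hst hφ.continuousOn hr'
    rw [hγ]
    exact hr r' hr1
  | change ht hΨ h ha ih =>
    rw [← mul_assoc]
    refine ih.change hΨ (by rwa [hγ]) ?_
    rwa [hγ]

/-- Continuations along concatenated paths compose. -/
lemma Continuation.trans {p q q' : M} {γ : Path p q} {δ : Path q q'} {Φ₀ Φ Ψ : AChart n M}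
    {g k : Aff n} (h : Continuation γ.toContinuousMap Φ₀ 1 Φ g)
    (h' : Continuation δ.toContinuousMap Φ 1 Ψ k) :
    Continuation (γ.trans δ).toContinuousMap Φ₀ 1 Ψ (g * k) := by
  let φ : I → I := fun t => ⟨t / 2, by constructor <;> linarith [t.2.1, t.2.2]⟩
  let ψ : I → I := fun t => ⟨(1 + t) / 2, by constructor <;> linarith [t.2.1, t.2.2]⟩
  have hφ : ∀ r, (γ.trans δ).toContinuousMap (φ r) = γ.toContinuousMap r := by
    intro r
    change (γ.trans δ) (φ r) = γ r
    rw [Path.trans_apply, dif_pos (by change (r : ℝ) / 2 ≤ 1 / 2; linarith [r.2.2])]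
    congr 1
    ext
    change 2 * ((r : ℝ) / 2) = r
    ring
  have hψ : ∀ r, (γ.trans δ).toContinuousMap (ψ r) = δ.toContinuousMap r := by
    intro r
    change (γ.trans δ) (ψ r) = δ r
    rw [Path.trans_apply]
    split_ifs with hr
    -- The two halves overlap only at the midpoint, where the concatenated path is evaluated on its
    -- first half.
    · have hr' : (1 + (r : ℝ)) / 2 ≤ 1 / 2 := hr
      have hr0 : r = 0 := Subtype.ext (le_antisymm (by simp; linarith) r.2.1)
      subst hr0
      rw [δ.source]
      convert γ.target
      change 2 * ((1 + (0 : ℝ)) / 2) = 1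
      norm_num
    · congr 1
      ext
      change 2 * ((1 + (r : ℝ)) / 2) - 1 = r
      ring
  have e0 : φ 0 = 0 := by ext; simp [φ]
  have e1 : φ 1 = ψ 0 := by ext; simp [φ, ψ]
  have e2 : ψ 1 = 1 := by ext; simp [ψ]
  obtain ⟨hΦ₀, h0⟩ := h.mem_start
  have hb : Continuation (γ.trans δ).toContinuousMap Φ₀ (φ 0) Φ₀ 1 := by
    rw [e0]
    refine .start hΦ₀ ?_
    rwa [← e0, hφ]
  have a1 := hb.reparam (φ := φ) (by fun_prop) (fun a b hab => by
    have : (a : ℝ) ≤ b := hab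
    change (a : ℝ) / 2 ≤ b / 2; linarith) hφ h
  rw [one_mul, e1] at a1
  have a2 := a1.reparam (φ := ψ) (by fun_prop) (fun a b hab => by
    have : (a : ℝ) ≤ b := hab
    change (1 + (a : ℝ)) / 2 ≤ (1 + b) / 2; linarith) hψ h'
  rwa [e2] at a2

/-- The local coordinate systems which near every point of their domain are obtained, up to the
translation by `x₀`, by continuation of `Φ₀` along a path. -/
def continuedCharts (p : M) (Φ₀ : AChart n M) (x₀ : ASpace n) : Set (AChart n M) :=
  {f | ∀ y ∈ f.source, ∃ (γ : Path p y) (Ψ : AChart n M) (g : Aff n),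
    Continuation γ.toContinuousMap Φ₀ 1 Ψ g ∧ ∀ᶠ z in 𝓝 y, f z = g (Ψ z) - x₀}

/-- Restricting `Ψ` to the path component of `q` in its domain lets every point be reached from `q`
without leaving `Ψ`, so the same `g` serves throughout. -/
lemma Continuation.exists_continuedChart {p q : M} {Φ₀ Ψ : AChart n M} {γ : Path p q} {g : Aff n}
    (h : Continuation γ.toContinuousMap Φ₀ 1 Ψ g) (x₀ : ASpace n) :
    ∃ f ∈ continuedCharts p Φ₀ x₀, q ∈ f.source ∧ f q = g (Ψ q) - x₀ := by
  have : LocallyPathConnectedSpace M := ChartedSpace.locallyPathConnectedSpace (ASpace n) M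
  have hq : q ∈ Ψ.source := by simpa using h.mem.2
  let S := pathComponentIn Ψ.source q
  have hS : IsOpen S := Ψ.open_source.pathComponentIn q
  let G : ASpace n ≃ₜ ASpace n :=
    g.toContinuousAffineEquiv.toHomeomorph.trans (Homeomorph.subRight x₀)
  let f : AChart n M := (Ψ.restr S).transHomeomorph G
  have hfs : f.source = Ψ.source ∩ S := Ψ.restr_source' S hS
  refine ⟨f, fun y hy => ?_, ?_, rfl⟩
  · rw [hfs] at hy
    obtain ⟨δ, hδ⟩ := hy.2
    have hδc : Continuation δ.toContinuousMap Ψ 1 Ψ 1 :=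
      (Continuation.start h.mem.1 (hδ 0)).move (unitInterval.nonneg') fun r _ => hδ r
    have := h.trans hδc
    rw [mul_one] at this
    exact ⟨γ.trans δ, Ψ, g, this, .of_forall fun z => rfl⟩
  · rw [hfs]
    exact ⟨hq, mem_pathComponentIn_self hq⟩

variable [AffineManifold n M]

lemma isHolonomy_hol {p : M} {Φ₀ : AChart n M} (hΦ₀ : Φ₀ ∈ atlas (ASpace n) M)
    (hp : p ∈ Φ₀.source) (β : FundamentalGroup M p) : IsHolonomy Φ₀ β (hol hΦ₀ hp β) :=
  (existsUnique_isHolonomy hΦ₀ hp β).choose_spec.1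

lemma isDevelopedTo_dev {p : M} {Φ₀ : AChart n M} (hΦ₀ : Φ₀ ∈ atlas (ASpace n) M)
    (hp : p ∈ Φ₀.source) (x : UniversalCover p) : IsDevelopedTo Φ₀ x (dev hΦ₀ hp x) :=
  (existsUnique_isDevelopedTo hΦ₀ hp x).choose_spec.1

/-- Developing along two paths with the same endpoints differs by an element of the holonomy. -/
lemma Continuation.exists_hol {p q : M} {Φ₀ : AChart n M} (hΦ₀ : Φ₀ ∈ atlas (ASpace n) M)
    (hp : p ∈ Φ₀.source) {γ γ' : Path p q} {Φ Ψ : AChart n M} {g k : Aff n}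
    (h : Continuation γ.toContinuousMap Φ₀ 1 Φ g) (h' : Continuation γ'.toContinuousMap Φ₀ 1 Ψ k) :
    ∃ β : FundamentalGroup M p, ∀ᶠ y in 𝓝 q, k (Ψ y) = hol hΦ₀ hp β (g (Φ y)) := by
  -- Up to homotopy `γ'` is this loop followed by `γ`, so its coordinate change is the holonomy of
  -- the loop times that of `γ`.
  refine ⟨FundamentalGroup.fromPath (Path.Homotopic.Quotient.mk (γ'.trans γ.symm)), ?_⟩
  obtain ⟨δ, hδ, hc⟩ := isHolonomy_hol hΦ₀ hp
    (FundamentalGroup.fromPath (Path.Homotopic.Quotient.mk (γ'.trans γ.symm)))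
  have h1 := hc.trans h
  have hhom : γ'.Homotopic (δ.trans γ) := by
    apply Path.Homotopic.Quotient.exact
    have hδ' : Path.Homotopic.Quotient.mk δ = Path.Homotopic.Quotient.mk (γ'.trans γ.symm) := hδ
    rw [Path.Homotopic.Quotient.mk_trans, hδ', Path.Homotopic.Quotient.mk_trans,
      Path.Homotopic.Quotient.trans_assoc, Path.Homotopic.Quotient.mk_symm,
      Path.Homotopic.Quotient.symm_trans, Path.Homotopic.Quotient.trans_refl]
  filter_upwards [h'.homotopic hhom h1] with y hy
  rw [hy, AffineEquiv.mul_def]; rfl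

/-- Two continuations at a point differ by a holonomy element. It fixes `x₀`, so once `x₀` is
subtracted only its linear part remains. -/
lemma isRadiantAtlas_continuedCharts [ConnectedSpace M] {p : M} {Φ₀ : AChart n M}
    (hΦ₀ : Φ₀ ∈ atlas (ASpace n) M) (hp : p ∈ Φ₀.source) {x₀ : ASpace n}
    (hx₀ : ∀ β : FundamentalGroup M p, hol hΦ₀ hp β x₀ = x₀) :
    IsRadiantAtlas (continuedCharts p Φ₀ x₀) := by
  have : LocallyPathConnectedSpace M := ChartedSpace.locallyPathConnectedSpace (ASpace n) M
  have : PathConnectedSpace M := .of_locallyPathConnectedSpace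
  refine ⟨fun x => ?_, fun f hf f' hf' x hx hx' => ?_⟩
  · let γ := PathConnectedSpace.somePath p x
    obtain ⟨Ψ, g, h⟩ := exists_continuation (γ := γ.toContinuousMap) hΦ₀ (by simpa using hp) 1
    obtain ⟨f, hf, hx, -⟩ := h.exists_continuedChart x₀
    exact ⟨f, hf, hx⟩
  · obtain ⟨γ, Ψ, g, h, hfe⟩ := hf x hx
    obtain ⟨γ', Ψ', g', h', hfe'⟩ := hf' x hx'
    obtain ⟨β, hβ⟩ := h.exists_hol hΦ₀ hp h'
    refine ⟨(hol hΦ₀ hp β).linear.toContinuousLinearEquiv, ?_⟩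
    filter_upwards [hfe, hfe', hβ] with y h1 h2 h3
    rw [h1, h2, h3]
    have := (hol hΦ₀ hp β).toAffineMap.linearMap_vsub (g (Ψ y)) x₀
    have hx := hx₀ β
    simp only [vsub_eq_sub] at this
    change _ = (hol hΦ₀ hp β).linear (g (Ψ y) - x₀)
    conv_lhs => rw [← hx]
    exact this.symm

end

end AffineMfd

end

/-! ### Conclusion -/

/-- The developing image of a closed radiant affine manifold of positive dimension does not contain
a fixed point of the affine holonomy. -/
theorem theorem3 (n : ℕ) (hn : 1 ≤ n) (M : Type*) [TopologicalSpace M] [T2Space M]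
    [CompactSpace M] [ConnectedSpace M] [ChartedSpace (AffineMfd.ASpace n) M]
    [AffineMfd.AffineManifold n M]
    (p : M) (Φ₀ : AffineMfd.AChart n M) (hΦ₀ : Φ₀ ∈ atlas (AffineMfd.ASpace n) M)
    (hp : p ∈ Φ₀.source)
    (x₀ : AffineMfd.ASpace n)
    (hx₀ : ∀ β : FundamentalGroup M p, AffineMfd.hol hΦ₀ hp β x₀ = x₀) :
    x₀ ∉ Set.range (AffineMfd.dev hΦ₀ hp) := by
  rintro ⟨x, hx⟩
  -- Makes the model space nontrivial, hence noncompact. For `n = 0` a single point would be a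
  -- counterexample.
  have : Nonempty (Fin n) := ⟨⟨0, hn⟩⟩
  obtain ⟨γ, Ψ, g, -, h, hy⟩ := AffineMfd.isDevelopedTo_dev hΦ₀ hp x
  obtain ⟨f, hf, hq, hfq⟩ := h.exists_continuedChart x₀
  refine (AffineMfd.isRadiantAtlas_continuedCharts hΦ₀ hp hx₀).apply_ne_zero hf hq ?_
  rw [hfq, ← hy, hx, sub_self]
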